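/- Let $F$ be a field of characteristic $\neq 2$. All algebras are unital but not necessarily associative, and subalgebras contain the unit $1$. For an $F$-algebra $A$ with a linear involution $*$ and $\gamma\in F\setminus\{0\}$, the Dickson double $D_\gamma(A)=A\oplus iA$ has multiplication $(a+ib)(c+id)=(ac+\gamma\, d b^*)+i(a^*d+cb)$ and involution $(a+ib)^*=a^*-ib$. A Cayley algebra over $F$ is an algebra with involution $O$ isomorphic to $D_\gamma(D_\beta(D_\alpha(F)))$ for some nonzero $\alpha,\beta,\gamma\in F$, where $F$ carries the identity involution. Put $\mathrm{im}(O)=\{x\in O: x^*=-x\}$ and, for a subalgebra $H\subseteq O$, $\mathrm{im}(H)=H\cap \mathrm{im}(O)$. For $U\subseteq O$, let $\langle U\rangle$ be the subalgebra generated by $U$. A nilpotent line is a one-dimensional subspace consisting of nilpotent elements. A two-dimensional subspace $U\subseteq\mathrm{im}(O)$ is - of type Q if it contains no nilpotent line; - of type D if it contains exactly one nilpotent line $L$ and there are $u\in L$, $v\in U$ with $uv\notin L$; - of type M if it contains exactly two nilpotent lines; - of type J if all its elements are nilpotent and there are $x,y\in U$ with $xy\neq 0$. Let $O$ be a Cayley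 algebra over $F$. Then: 1. For every four-dimensional subalgebra $H$ of $O$ there is a two-dimensional subspace $U\subseteq \mathrm{im}(O)$ of type Q, M, D or J such that $U\subseteq H$ and $\langle U\rangle=H$. 2. The collection $\mathcal B=\{\mathrm{im}(H): H \text{ is a four-dimensional subalgebra of } O\}$ is an inclusion-minimal $(7,3,2)$-$q$-covering design on $\mathrm{im}(O)$: $\dim \mathrm{im}(O)=7$, every $B\in\mathcal B$ is a three-dimensional subspace of $\mathrm{im}(O)$, every two-dimensional subspace of $\mathrm{im}(O)$ is contained in some $B\in\mathcal B$, and no proper subcollection of $\mathcal B$ has this last property. -/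

import Mathlib

/-- An involution of a unital, not necessarily associative `F`-algebra `A`: a linear
anti-automorphism of order dividing two. -/
class AlgInvolution (F : Type*) (A : Type*) [Field F] [NonAssocRing A] [Module F A] where
  /-- The map `a ↦ a*`. -/
  conj : A →ₗ[F] A
  conj_mul : ∀ a b : A, conj (a * b) = conj b * conj a
  conj_conj : ∀ a : A, conj (conj a) = a

/-- The involution `a ↦ a*` of `A`, with the ground field explicit. -/
abbrev involution (F : Type*) {A : Type*} [Field F] [NonAssocRing A] [Module F A]
    [AlgInvolution F A] : A →ₗ[F] A :=
  AlgInvolution.conj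

/-- The involution of the one-dimensional algebra `F` is the identity. -/
instance AlgInvolution.base (F : Type*) [Field F] : AlgInvolution F F where
  conj := LinearMap.id
  conj_mul a b := mul_comm a b
  conj_conj _ := rfl

/-- The Dickson double `D_γ(A) = A ⊕ iA`; the pair `(a, b)` stands for `a + ib`. -/
def DicksonDouble {F : Type*} (_γ : F) (A : Type*) : Type _ := A × A

namespace DicksonDouble

set_option linter.unusedSectionVars false

section
variable {F A : Type*} [Field F] (γ : F) [NonAssocRing A] [Module F A]

instance : AddCommGroup (DicksonDouble γ A) := inferInstanceAs (AddCommGroup (A × A))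

instance : Module F (DicksonDouble γ A) := inferInstanceAs (Module F (A × A))

variable {γ}

@[ext] theorem ext {x y : DicksonDouble γ A} (h₁ : x.1 = y.1) (h₂ : x.2 = y.2) : x = y :=
  Prod.ext h₁ h₂

@[simp] theorem fst_add (x y : DicksonDouble γ A) : (x + y).1 = x.1 + y.1 := rfl
@[simp] theorem snd_add (x y : DicksonDouble γ A) : (x + y).2 = x.2 + y.2 := rfl
@[simp] theorem fst_zero : (0 : DicksonDouble γ A).1 = 0 := rfl
@[simp] theorem snd_zero : (0 : DicksonDouble γ A).2 = 0 := rfl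
@[simp] theorem fst_smul (r : F) (x : DicksonDouble γ A) : (r • x).1 = r • x.1 := rfl
@[simp] theorem snd_smul (r : F) (x : DicksonDouble γ A) : (r • x).2 = r • x.2 := rfl

variable (γ) [AlgInvolution F A]

/-- `(a + ib)(c + id) = (ac + γ d b*) + i(a* d + c b)`. -/
instance : Mul (DicksonDouble γ A) where
  mul x y := (x.1 * y.1 + γ • (y.2 * involution F x.2), involution F x.1 * y.2 + y.1 * x.2)

instance : One (DicksonDouble γ A) where
  one := ((1 : A), (0 : A))

variable {γ}

@[simp] theorem fst_one : (1 : DicksonDouble γ A).1 = 1 := rfl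
@[simp] theorem snd_one : (1 : DicksonDouble γ A).2 = 0 := rfl
@[simp] theorem fst_mul (x y : DicksonDouble γ A) :
    (x * y).1 = x.1 * y.1 + γ • (y.2 * involution F x.2) := rfl
@[simp] theorem snd_mul (x y : DicksonDouble γ A) :
    (x * y).2 = involution F x.1 * y.2 + y.1 * x.2 := rfl

theorem conj_one : involution F (1 : A) = 1 := by
  have h := AlgInvolution.conj_mul (F := F) (involution F (1 : A)) 1
  rw [mul_one, AlgInvolution.conj_conj, mul_one] at h
  exact h.symm

instance : NonAssocRing (DicksonDouble γ A) :=
  { (inferInstance : AddCommGroup (DicksonDouble γ A)),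
    (inferInstance : Mul (DicksonDouble γ A)),
    (inferInstance : One (DicksonDouble γ A)) with
    left_distrib := fun x y z => by
      ext <;> simp [mul_add, add_mul] <;> abel
    right_distrib := fun x y z => by
      ext <;> simp [mul_add, add_mul] <;> abel
    zero_mul := fun x => by ext <;> simp
    mul_zero := fun x => by ext <;> simp
    one_mul := fun x => by ext <;> simp [conj_one]
    mul_one := fun x => by ext <;> simp }

instance [IsScalarTower F A A] [SMulCommClass F A A] :
    IsScalarTower F (DicksonDouble γ A) (DicksonDouble γ A) where
  smul_assoc r x y := by
    ext <;> simp [smul_mul_assoc, mul_smul_comm, smul_comm γ r]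

instance [IsScalarTower F A A] [SMulCommClass F A A] :
    SMulCommClass F (DicksonDouble γ A) (DicksonDouble γ A) where
  smul_comm r x y := by
    ext <;> simp [smul_mul_assoc, mul_smul_comm, smul_comm γ r]

/-- `(a + ib)* = a* - ib`. -/
instance : AlgInvolution F (DicksonDouble γ A) where
  conj :=
    { toFun := fun x => (involution F x.1, -x.2)
      map_add' := fun x y => by
        apply Prod.ext
        · exact map_add (involution F) x.1 y.1
        · exact neg_add x.2 y.2
      map_smul' := fun r x => by
        apply Prod.ext
        · exact map_smul (involution F) r x.1
        · exact (smul_neg r x.2).symm }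
  conj_mul x y := by
    apply Prod.ext
    · change involution F (x.1 * y.1 + γ • (y.2 * involution F x.2))
        = involution F y.1 * involution F x.1 + γ • (-x.2 * involution F (-y.2))
      simp [AlgInvolution.conj_mul, AlgInvolution.conj_conj]
    · change -(involution F x.1 * y.2 + y.1 * x.2)
        = involution F (involution F y.1) * -x.2 + involution F x.1 * -y.2
      simp [AlgInvolution.conj_conj, add_comm]
  conj_conj x := by
    apply Prod.ext
    · exact AlgInvolution.conj_conj x.1
    · exact neg_neg x.2

end

end DicksonDouble

/-- `O` is a Cayley (octonion) algebra, that is, an eight-dimensional Cayley-Dickson algebra: as an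
algebra with involution it is isomorphic to `D_γ(D_β(D_α(F)))` with `α, β, γ` nonzero. -/
def IsCayleyAlgebra (F O : Type*) [Field F] [NonAssocRing O] [Module F O]
    [AlgInvolution F O] : Prop :=
  ∃ α β γ : F, α ≠ 0 ∧ β ≠ 0 ∧ γ ≠ 0 ∧
    ∃ e : DicksonDouble γ (DicksonDouble β (DicksonDouble α F)) ≃ₗ[F] O,
      (∀ x y, e (x * y) = e x * e y) ∧
      (∀ x, e (involution F x) = involution F (e x))

section
variable {F A : Type*} [Field F] [NonAssocRing A] [Module F A]

/-- The space `im(A)` of imaginary elements: the `(-1)`-eigenspace of the involution. -/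
def imaginary (F A : Type*) [Field F] [NonAssocRing A] [Module F A] [AlgInvolution F A] :
    Submodule F A where
  carrier := {a | involution F a = -a}
  add_mem' := fun {a b} ha hb => by
    have ha' : involution F a = -a := ha
    have hb' : involution F b = -b := hb
    change involution F (a + b) = -(a + b)
    rw [map_add, ha', hb', neg_add]
  zero_mem' := by
    change involution F (0 : A) = -0
    simp
  smul_mem' := fun r a ha => by
    have ha' : involution F a = -a := ha
    change involution F (r • a) = -(r • a)
    rw [map_smul, ha', smul_neg]

/-- The imaginary part `im(H)` of a subalgebra `H`, whose involution is the restriction of that of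
the ambient algebra. -/
def imPart [AlgInvolution F A] (H : NonUnitalSubalgebra F A) : Submodule F A :=
  H.toSubmodule ⊓ imaginary F A

/-- The unital subalgebra `⟨s⟩` generated by `s`: the smallest subalgebra containing `1` and `s`. -/
def generatedSubalgebra (F : Type*) {A : Type*} [Field F] [NonAssocRing A] [Module F A]
    [IsScalarTower F A A] [SMulCommClass F A A] (s : Set A) : NonUnitalSubalgebra F A :=
  NonUnitalAlgebra.adjoin F (insert 1 s)

/-- Powers in a not necessarily associative algebra, bracketed to the right. In an alternative
algebra (such as a Cayley algebra) the bracketing does not matter. -/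
def nonAssocPow (x : A) : ℕ → A
  | 0 => 1
  | n + 1 => x * nonAssocPow x n

/-- Some power of `x` vanishes. -/
def IsNilpotentElt (x : A) : Prop := ∃ n : ℕ, nonAssocPow x n = 0

/-- The nilpotent lines in `U`: its one-dimensional subspaces consisting of nilpotent elements. -/
def nilpotentLines (U : Submodule F A) : Set (Submodule F A) :=
  {L | L ≤ U ∧ Module.finrank F L = 1 ∧ ∀ x ∈ L, IsNilpotentElt x}

/-! The types below are applied to two-dimensional subspaces of the imaginary elements. -/

/-- Type Q: no nilpotent lines. -/
def IsTypeQ (U : Submodule F A) : Prop := nilpotentLines U = ∅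

/-- Type D: exactly one nilpotent line `L`, and not all products `u * v` with `u ∈ L`, `v ∈ U`
lie in `L`. -/
def IsTypeD (U : Submodule F A) : Prop :=
  ∃ L, nilpotentLines U = {L} ∧ ¬ ∀ u ∈ L, ∀ v ∈ U, u * v ∈ L

/-- Type M: exactly two nilpotent lines. -/
def IsTypeM (U : Submodule F A) : Prop := (nilpotentLines U).encard = 2

/-- Type J: all elements are nilpotent, but not all products of two elements are zero. -/
def IsTypeJ (U : Submodule F A) : Prop :=
  (∀ x ∈ U, IsNilpotentElt x) ∧ ¬ ∀ x ∈ U, ∀ y ∈ U, x * y = 0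

end

/-- A `(v, b, t)`-`q`-covering design on the `v`-dimensional space `V` (a subspace of some ambient
vector space): a collection of `b`-dimensional subspaces of `V` such that every `t`-dimensional
subspace of `V` is contained in at least one of them. -/
structure IsQCoveringDesign {F E : Type*} [Field F] [AddCommGroup E] [Module F E]
    (V : Submodule F E) (v b t : ℕ) (𝓑 : Set (Submodule F E)) : Prop where
  finite_space : Module.Finite F V
  finrank_space : Module.finrank F V = v
  block_le : ∀ B ∈ 𝓑, B ≤ V
  finrank_block : ∀ B ∈ 𝓑, Module.finrank F B = b
  covers : ∀ T : Submodule F E, T ≤ V → Module.finrank F T = t → ∃ B ∈ 𝓑, T ≤ B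

/-! Everything rests on a few coordinate-free laws: alternativity, squares of imaginary elements
being scalars, the splitting of `O` into scalars and imaginary elements, nondegeneracy of the polar
form `xy + yx`, and dimension eight. They are checked in coordinates on the iterated double and
transported to `O`.

Call a plane `U` of imaginary elements closed if `F1 ⊕ U` is multiplicatively closed. If `U` is not
closed and lies in a four-dimensional subalgebra `H`, then `⟨U⟩` strictly contains the
three-dimensional `F1 ⊕ U`, so `⟨U⟩ = H`; moreover the quadratic form on `U` leaves only the types
Q, M, D, J (`type_of_not_closed`). The first claim thus needs a non-closed plane in `im(H)`, given
by `exists_pair_not_closed`. If all planes of a three-dimensional `W` were closed, each would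
contain a null vector, so `W` would contain a plane `N` with zero multiplication, on which any
further `v ∈ W` acts as a scalar `c`. The left annihilator of `N` is `N` itself
(`mem_span_of_mul_null_eq_zero`), so `v - c ∈ N`; then `c = 0` and `v ∈ N`, a contradiction.

For covering, `1, x, y, yx` always span a subalgebra. It has dimension four when the plane of `x, y`
is not closed; a closed plane is placed in such a subalgebra with different generators
(`exists_subalgebra_of_plane`). Minimality holds because a plane generating `H` lies in no other
block than `im(H)`. -/

/-- The structural facts about a Cayley algebra that the covering theorem rests on. -/
structure CayleyLaws (F O : Type*) [Field F] [NonAssocRing O] [Module F O]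
    [AlgInvolution F O] : Prop where
  left_alt : ∀ x y : O, x * (x * y) = (x * x) * y
  right_alt : ∀ x y : O, (y * x) * x = y * (x * x)
  sq_imaginary : ∀ x ∈ imaginary F O, ∃ c : F, x * x = c • (1 : O)
  exists_sub_mem : ∀ x : O, ∃ c : F, x - c • (1 : O) ∈ imaginary F O
  nondegenerate : ∀ x ∈ imaginary F O, x ≠ 0 → ∃ z ∈ imaginary F O, x * z + z * x = 1
  finrank_eq : Module.finrank F O = 8

theorem mem_imaginary {F A : Type*} [Field F] [NonAssocRing A] [Module F A] [AlgInvolution F A]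
    {x : A} : x ∈ imaginary F A ↔ involution F x = -x := Iff.rfl

/-! ### The laws in coordinates on the iterated double -/

namespace DicksonDouble

set_option linter.unusedSectionVars false

section
variable {F A : Type*} [Field F] {γ : F} [NonAssocRing A] [Module F A] [AlgInvolution F A]

@[simp] theorem fst_neg (x : DicksonDouble γ A) : (-x).1 = -x.1 := rfl
@[simp] theorem snd_neg (x : DicksonDouble γ A) : (-x).2 = -x.2 := rfl
@[simp] theorem fst_sub (x y : DicksonDouble γ A) : (x - y).1 = x.1 - y.1 := rfl
@[simp] theorem snd_sub (x y : DicksonDouble γ A) : (x - y).2 = x.2 - y.2 := rfl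
@[simp] theorem fst_involution (x : DicksonDouble γ A) :
    (involution F x).1 = involution F x.1 := rfl
@[simp] theorem snd_involution (x : DicksonDouble γ A) : (involution F x).2 = -x.2 := rfl
@[simp] theorem involution_base (x : F) : involution F x = x := rfl

theorem mem_imaginary_iff {x : DicksonDouble γ A} :
    x ∈ imaginary F (DicksonDouble γ A) ↔ x.1 ∈ imaginary F A := by
  rw [mem_imaginary, mem_imaginary]
  constructor
  · intro h
    exact congrArg Prod.fst h
  · intro h
    exact DicksonDouble.ext h rfl

end

variable {F : Type*} [Field F] (α β γ : F)

/-- The eight-dimensional Cayley-Dickson algebra. -/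
abbrev Triple : Type _ := DicksonDouble γ (DicksonDouble β (DicksonDouble α F))

variable {α β γ}

theorem triple_mem_imaginary_iff (h2 : (2 : F) ≠ 0) {x : Triple α β γ} :
    x ∈ imaginary F (Triple α β γ) ↔ x.1.1.1 = 0 := by
  rw [mem_imaginary_iff, mem_imaginary_iff, mem_imaginary_iff, mem_imaginary, involution_base]
  constructor
  · intro h
    have : (2 : F) * x.1.1.1 = 0 := by linear_combination h
    exact (mul_eq_zero.mp this).resolve_left h2
  · intro h
    rw [h, neg_zero]

-- In coordinates alternativity becomes eight polynomial identities over the commutative field `F`.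
set_option maxHeartbeats 1000000 in
theorem triple_left_alt (x y : Triple α β γ) : x * (x * y) = (x * x) * y := by
  ext <;> simp only [fst_mul, snd_mul, fst_add, snd_add, fst_smul, snd_smul, fst_involution,
    snd_involution, involution_base, fst_neg, snd_neg, smul_eq_mul] <;> ring

set_option maxHeartbeats 1000000 in
theorem triple_right_alt (x y : Triple α β γ) : (y * x) * x = y * (x * x) := by
  ext <;> simp only [fst_mul, snd_mul, fst_add, snd_add, fst_smul, snd_smul, fst_involution,
    snd_involution, involution_base, fst_neg, snd_neg, smul_eq_mul] <;> ring

theorem triple_sq (x : Triple α β γ) (hx : x.1.1.1 = 0) :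
    x * x = ((x * x).1.1.1) • (1 : Triple α β γ) := by
  ext <;> simp only [fst_mul, snd_mul, fst_add, snd_add, fst_smul, snd_smul, fst_involution,
    snd_involution, involution_base, fst_neg, snd_neg, fst_one, snd_one, fst_zero, snd_zero,
    smul_eq_mul, hx] <;> ring

/-- The polar form is diagonal in the seven imaginary coordinates, its entries being `±2` times
products of `α, β, γ`. Pairing with coordinate vectors therefore detects every coordinate of `x`. -/
theorem triple_nondegenerate (h2 : (2 : F) ≠ 0) (hα : α ≠ 0) (hβ : β ≠ 0) (hγ : γ ≠ 0)
    (x : Triple α β γ) (hx : x.1.1.1 = 0) (hx0 : x ≠ 0) :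
    ∃ z : Triple α β γ, z.1.1.1 = 0 ∧ ∃ c : F, c ≠ 0 ∧ x * z + z * x = c • 1 := by
  by_contra! H
  have key : ∀ z : Triple α β γ, z.1.1.1 = 0 →
      2 * (α * (x.1.1.2 * z.1.1.2) + β * (x.1.2.1 * z.1.2.1 - α * (x.1.2.2 * z.1.2.2))
        + γ * (x.2.1.1 * z.2.1.1 - α * (x.2.1.2 * z.2.1.2)
          - β * (x.2.2.1 * z.2.2.1 - α * (x.2.2.2 * z.2.2.2)))) = 0 := by
    intro z hz
    by_contra hc
    refine H z hz _ hc ?_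
    ext <;> simp only [fst_mul, snd_mul, fst_add, snd_add, fst_smul, snd_smul, fst_involution,
    snd_involution, involution_base, fst_neg, snd_neg, fst_one, snd_one, fst_zero, snd_zero,
    smul_eq_mul, hx, hz] <;> ring
  apply hx0
  have e1 := key (((0, 1), (0, 0)), ((0, 0), (0, 0))) rfl
  have e2 := key (((0, 0), (1, 0)), ((0, 0), (0, 0))) rfl
  have e3 := key (((0, 0), (0, 1)), ((0, 0), (0, 0))) rfl
  have e4 := key (((0, 0), (0, 0)), ((1, 0), (0, 0))) rfl
  have e5 := key (((0, 0), (0, 0)), ((0, 1), (0, 0))) rfl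
  have e6 := key (((0, 0), (0, 0)), ((0, 0), (1, 0))) rfl
  have e7 := key (((0, 0), (0, 0)), ((0, 0), (0, 1))) rfl
  simp only [mul_zero, mul_one, add_zero, zero_add, sub_zero, zero_sub, mul_neg, neg_neg,
    neg_eq_zero, mul_eq_zero, h2, hα, hβ, hγ, false_or] at e1 e2 e3 e4 e5 e6 e7
  ext <;> assumption

theorem triple_finrank : Module.finrank F (Triple α β γ) = 8 := by
  change Module.finrank F (((F × F) × (F × F)) × ((F × F) × (F × F))) = 8
  simp

theorem triple_laws (h2 : (2 : F) ≠ 0) (hα : α ≠ 0) (hβ : β ≠ 0) (hγ : γ ≠ 0) :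
    CayleyLaws F (Triple α β γ) where
  left_alt := triple_left_alt
  right_alt := triple_right_alt
  sq_imaginary x hx := ⟨_, triple_sq x ((triple_mem_imaginary_iff h2).mp hx)⟩
  exists_sub_mem x := ⟨x.1.1.1, (triple_mem_imaginary_iff h2).mpr (by simp)⟩
  nondegenerate x hx hx0 := by
    rw [triple_mem_imaginary_iff h2] at hx
    obtain ⟨z, hz, c, hc, h⟩ := triple_nondegenerate h2 hα hβ hγ x hx hx0
    refine ⟨c⁻¹ • z, (triple_mem_imaginary_iff h2).mpr (by simp [hz]), ?_⟩
    rw [mul_smul_comm, smul_mul_assoc, ← smul_add, h, smul_smul, inv_mul_cancel₀ hc, one_smul]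
  finrank_eq := triple_finrank

end DicksonDouble

theorem CayleyLaws.transport {F A O : Type*} [Field F] [NonAssocRing A] [Module F A]
    [AlgInvolution F A] [NonAssocRing O] [Module F O] [AlgInvolution F O] (h : CayleyLaws F A)
    (e : A ≃ₗ[F] O) (hmul : ∀ x y, e (x * y) = e x * e y)
    (hinv : ∀ x, e (involution F x) = involution F (e x)) : CayleyLaws F O := by
  have hone : e 1 = 1 := by
    have h1 := hmul 1 (e.symm 1)
    rw [one_mul, e.apply_symm_apply, mul_one] at h1
    exact h1.symm
  have him : ∀ x, e x ∈ imaginary F O ↔ x ∈ imaginary F A := by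
    intro x
    rw [mem_imaginary, mem_imaginary, ← hinv, ← map_neg, e.injective.eq_iff]
  refine ⟨?_, ?_, ?_, ?_, ?_, ?_⟩
  · intro x y
    obtain ⟨x, rfl⟩ := e.surjective x
    obtain ⟨y, rfl⟩ := e.surjective y
    simp only [← hmul, h.left_alt]
  · intro x y
    obtain ⟨x, rfl⟩ := e.surjective x
    obtain ⟨y, rfl⟩ := e.surjective y
    simp only [← hmul, h.right_alt]
  · intro x hx
    obtain ⟨x, rfl⟩ := e.surjective x
    obtain ⟨c, hc⟩ := h.sq_imaginary x ((him x).mp hx)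
    exact ⟨c, by rw [← hmul, hc, map_smul, hone]⟩
  · intro x
    obtain ⟨x, rfl⟩ := e.surjective x
    obtain ⟨c, hc⟩ := h.exists_sub_mem x
    refine ⟨c, ?_⟩
    rw [← hone, ← map_smul, ← map_sub]
    exact (him _).mpr hc
  · intro x hx hx0
    obtain ⟨x, rfl⟩ := e.surjective x
    obtain ⟨z, hz, hxz⟩ := h.nondegenerate x ((him x).mp hx) (fun h0 => hx0 (by rw [h0, map_zero]))
    exact ⟨e z, (him z).mpr hz, by rw [← hmul, ← hmul, ← map_add, hxz, hone]⟩
  · rw [← e.finrank_eq, h.finrank_eq]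

theorem IsCayleyAlgebra.laws {F O : Type*} [Field F] [NonAssocRing O] [Module F O]
    [AlgInvolution F O] (h2 : (2 : F) ≠ 0) (hO : IsCayleyAlgebra F O) : CayleyLaws F O := by
  obtain ⟨α, β, γ, hα, hβ, hγ, e, hmul, hinv⟩ := hO
  exact (DicksonDouble.triple_laws h2 hα hβ hγ).transport e hmul hinv

/-! ### Linear algebra of pairs and planes -/

section

open Submodule

theorem Submodule.mem_one_sup_span_pair {F A : Type*} [Field F] [NonAssocRing A] [Module F A]
    {x y w : A} : w ∈ span F {(1 : A)} ⊔ span F {x, y} ↔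
      ∃ a b d : F, w = a • (1 : A) + b • x + d • y := by
  simp only [mem_sup, mem_span_singleton, mem_span_pair]
  constructor
  · rintro ⟨_, ⟨a, rfl⟩, _, ⟨b, d, rfl⟩, rfl⟩
    exact ⟨a, b, d, by rw [add_assoc]⟩
  · rintro ⟨a, b, d, rfl⟩
    exact ⟨_, ⟨a, rfl⟩, _, ⟨b, d, rfl⟩, by rw [add_assoc]⟩

theorem Submodule.exists_mem_notMem_of_finrank_lt {F V : Type*} [Field F] [AddCommGroup V]
    [Module F V] [Module.Finite F V] {S W : Submodule F V}
    (h : Module.finrank F S < Module.finrank F W) : ∃ v ∈ W, v ∉ S := by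
  by_contra! H
  exact absurd (finrank_mono (show W ≤ S from H)) (not_le.mpr h)

theorem Submodule.finrank_span_pair_le {F V : Type*} [Field F] [AddCommGroup V] [Module F V]
    (x y : V) : Module.finrank F (span F {x, y}) ≤ 2 := by
  have h := finrank_range_le_card (R := F) ![x, y]
  rwa [Matrix.range_cons_cons_empty, Set.finrank, Fintype.card_fin] at h

theorem LinearIndependent.finrank_span_pair {F V : Type*} [Field F] [AddCommGroup V] [Module F V]
    {x y : V} (h : LinearIndependent F ![x, y]) : Module.finrank F (span F {x, y}) = 2 := by
  have h' := finrank_span_eq_card h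
  rwa [Matrix.range_cons_cons_empty, Fintype.card_fin] at h'

theorem LinearIndependent.pair_of_notMem_span {F V : Type*} [Field F] [AddCommGroup V] [Module F V]
    {x y : V} (hx : x ≠ 0) (hy : y ∉ span F {x}) : LinearIndependent F ![x, y] := by
  rw [LinearIndependent.pair_iff' hx]
  intro a ha
  exact hy (mem_span_singleton.mpr ⟨a, ha⟩)

theorem Submodule.exists_pair_of_finrank_eq_two {F V : Type*} [Field F] [AddCommGroup V]
    [Module F V] [Module.Finite F V] {U : Submodule F V} (hU : Module.finrank F U = 2) {u : V}
    (hu : u ∈ U) (hu0 : u ≠ 0) :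
    ∃ v ∈ U, LinearIndependent F ![u, v] ∧ span F {u, v} = U := by
  obtain ⟨v, hv, hvu⟩ := exists_mem_notMem_of_finrank_lt (S := span F {u}) (W := U)
    (by rw [finrank_span_singleton hu0, hU]; norm_num)
  have hli := LinearIndependent.pair_of_notMem_span hu0 hvu
  refine ⟨v, hv, hli, eq_of_le_of_finrank_eq ?_ (by rw [hli.finrank_span_pair, hU])⟩
  rw [span_le]
  rintro _ (rfl | rfl)
  exacts [hu, hv]

theorem Submodule.exists_span_pair_of_finrank_eq_two {F V : Type*} [Field F] [AddCommGroup V]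
    [Module F V] [Module.Finite F V] {U : Submodule F V} (hU : Module.finrank F U = 2) :
    ∃ u v : V, LinearIndependent F ![u, v] ∧ span F {u, v} = U := by
  obtain ⟨u, hu, hu0⟩ := exists_mem_notMem_of_finrank_lt (S := (⊥ : Submodule F V)) (W := U)
    (by rw [finrank_bot, hU]; norm_num)
  obtain ⟨v, -, h⟩ := exists_pair_of_finrank_eq_two hU hu (fun h => hu0 (by rw [h]; exact zero_mem _))
  exact ⟨u, v, h⟩

theorem Submodule.mul_mem_span_of_forall_mem {F A : Type*} [Field F] [NonAssocRing A] [Module F A]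
    [IsScalarTower F A A] [SMulCommClass F A A] {s : Set A} {M : Submodule F A}
    (hs : ∀ a ∈ s, ∀ b ∈ s, a * b ∈ M) {a b : A} (ha : a ∈ span F s) (hb : b ∈ span F s) :
    a * b ∈ M := by
  induction ha using span_induction with
  | mem a ha =>
    induction hb using span_induction with
    | mem b hb => exact hs a ha b hb
    | zero => rw [mul_zero]; exact zero_mem _
    | add b c _ _ hb hc => rw [mul_add]; exact add_mem hb hc
    | smul r b _ hb => rw [mul_smul_comm]; exact smul_mem _ r hb
  | zero => rw [zero_mul]; exact zero_mem _
  | add a c _ _ ha hc => rw [add_mul]; exact add_mem ha hc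
  | smul r a _ ha => rw [smul_mul_assoc]; exact smul_mem _ r ha

/-! ### Scalars, polar form and dimension counts from the laws -/

namespace CayleyLaws

variable {F O : Type*} [Field F] [NonAssocRing O] [Module F O] [AlgInvolution F O]

theorem finite (h : CayleyLaws F O) : Module.Finite F O :=
  Module.finite_of_finrank_pos (by rw [h.finrank_eq]; norm_num)

theorem one_ne_zero (h : CayleyLaws F O) : (1 : O) ≠ 0 := by
  intro h1
  have : Nontrivial O := Module.nontrivial_of_finrank_pos (R := F) (by rw [h.finrank_eq]; norm_num)
  obtain ⟨x, hx⟩ := exists_ne (0 : O)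
  exact hx (by rw [← mul_one x, h1, mul_zero])

theorem smul_one_eq_zero (h : CayleyLaws F O) {c : F} (hc : c • (1 : O) = 0) : c = 0 :=
  (smul_eq_zero.mp hc).resolve_right h.one_ne_zero

theorem eq_zero_of_smul_one_mem (h : CayleyLaws F O) (h2 : (2 : F) ≠ 0) {c : F}
    (hc : c • (1 : O) ∈ imaginary F O) : c = 0 := by
  rw [mem_imaginary, map_smul, DicksonDouble.conj_one] at hc
  refine (mul_eq_zero.mp (h.smul_one_eq_zero (c := 2 * c) ?_)).resolve_left h2
  linear_combination (norm := module) hc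

theorem coeffs_eq_zero (h : CayleyLaws F O) (h2 : (2 : F) ≠ 0) {x y : O}
    (hx : x ∈ imaginary F O) (hy : y ∈ imaginary F O) (hxy : LinearIndependent F ![x, y])
    {a b d : F} (he : a • (1 : O) + b • x + d • y = 0) : a = 0 ∧ b = 0 ∧ d = 0 := by
  have ha : a = 0 := by
    apply h.eq_zero_of_smul_one_mem h2
    have : a • (1 : O) = -(b • x + d • y) := by linear_combination (norm := module) he
    rw [this]
    exact neg_mem (add_mem (smul_mem _ _ hx) (smul_mem _ _ hy))
  subst ha
  rw [zero_smul, zero_add] at he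
  exact ⟨rfl, LinearIndependent.pair_iff.mp hxy b d he⟩

theorem exists_polar (h : CayleyLaws F O) {x y : O} (hx : x ∈ imaginary F O)
    (hy : y ∈ imaginary F O) : ∃ s : F, x * y + y * x = s • (1 : O) := by
  obtain ⟨p, hp⟩ := h.sq_imaginary x hx
  obtain ⟨q, hq⟩ := h.sq_imaginary y hy
  obtain ⟨r, hr⟩ := h.sq_imaginary (x + y) (add_mem hx hy)
  refine ⟨r - p - q, ?_⟩
  rw [sub_smul, sub_smul, ← hp, ← hq, ← hr]
  simp only [mul_add, add_mul]
  abel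

/-- Right alternativity linearised at `u + z`. When `uz + zu` is a scalar, right multiplications by
`u` and `z` satisfy a Clifford relation. -/
theorem mul_mul_add_mul_mul (h : CayleyLaws F O) (p u z : O) :
    (p * u) * z + (p * z) * u = p * (u * z + z * u) := by
  have h1 := h.right_alt (u + z) p
  simp only [mul_add, add_mul, h.right_alt] at h1 ⊢
  rw [← sub_eq_zero] at h1 ⊢
  rw [← h1]
  abel

theorem finrank_one_sup (h : CayleyLaws F O) (h2 : (2 : F) ≠ 0) {U : Submodule F O}
    (hU : U ≤ imaginary F O) :
    Module.finrank F (span F {(1 : O)} ⊔ U : Submodule F O) = Module.finrank F U + 1 := by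
  have := h.finite
  have hinf : span F {(1 : O)} ⊓ U = ⊥ := by
    rw [eq_bot_iff]
    rintro x ⟨hx1, hxU⟩
    obtain ⟨c, rfl⟩ := mem_span_singleton.mp hx1
    rw [h.eq_zero_of_smul_one_mem h2 (hU hxU), zero_smul]
    exact zero_mem _
  have := finrank_sup_add_finrank_inf_eq (span F {(1 : O)}) U
  rw [hinf, finrank_bot, finrank_span_singleton h.one_ne_zero] at this
  omega

theorem finrank_inf_imaginary (h : CayleyLaws F O) (h2 : (2 : F) ≠ 0) {S : Submodule F O}
    (hS : (1 : O) ∈ S) :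
    Module.finrank F S = Module.finrank F (S ⊓ imaginary F O : Submodule F O) + 1 := by
  have : span F {(1 : O)} ⊔ S ⊓ imaginary F O = S := by
    apply le_antisymm
    · rw [sup_le_iff, span_singleton_le_iff_mem]
      exact ⟨hS, inf_le_left⟩
    · intro x hx
      obtain ⟨c, hc⟩ := h.exists_sub_mem x
      rw [← add_sub_cancel (c • (1 : O)) x]
      exact add_mem (mem_sup_left (smul_mem _ _ (mem_span_singleton_self _)))
        (mem_sup_right ⟨sub_mem hx (smul_mem _ _ hS), hc⟩)
  rw [← h.finrank_one_sup h2 inf_le_right, this]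

/-! ### Annihilators of null planes, and closed planes -/

variable [IsScalarTower F O O]

/-- The elements annihilating two null vectors from the left form a space of dimension at most
two, given vectors dual to them. -/
theorem finrank_le_two_of_dual (h : CayleyLaws F O) {u w z t : O}
    (huz : u * z + z * u = 1) (hwz : w * z + z * w = 0)
    (hut : u * t + t * u = 0) (hwt : w * t + t * w = 1) (V : Submodule F O)
    (hV : ∀ p ∈ V, p * u = 0 ∧ p * w = 0) : Module.finrank F V ≤ 2 := by
  have := h.finite
  have Ruz : ∀ p, (p * z) * u = p - (p * u) * z := fun p => by
    rw [eq_sub_iff_add_eq', h.mul_mul_add_mul_mul, huz, mul_one]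
  have Rwz : ∀ p, (p * z) * w = -((p * w) * z) := fun p => by
    rw [eq_neg_iff_add_eq_zero, add_comm, h.mul_mul_add_mul_mul, hwz, mul_zero]
  have Rut : ∀ p, (p * t) * u = -((p * u) * t) := fun p => by
    rw [eq_neg_iff_add_eq_zero, add_comm, h.mul_mul_add_mul_mul, hut, mul_zero]
  have Rwt : ∀ p, (p * t) * w = p - (p * w) * t := fun p => by
    rw [eq_sub_iff_add_eq', h.mul_mul_add_mul_mul, hwt, mul_one]
  let R (a : O) : O →ₗ[F] O := LinearMap.mulRight F a
  -- Four copies of `V` embed in `O` by `(p, q, r, s) ↦ p + qz + rt + (sz)t`, so `4 dim V ≤ 8`.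
  -- Right multiplication by `w` turns the sum into `r + sz`, and then by `u` into `s`; with `r = s
  -- = 0`, multiplication by `u` isolates `q`.
  let f : ((V × V) × (V × V)) →ₗ[F] O :=
    ((V.subtype.coprod (R z ∘ₗ V.subtype)).coprod
      ((R t ∘ₗ V.subtype).coprod (R t ∘ₗ R z ∘ₗ V.subtype)))
  have hf : Function.Injective f := by
    rw [← LinearMap.ker_eq_bot, LinearMap.ker_eq_bot']
    rintro ⟨⟨⟨p, hp⟩, ⟨q, hq⟩⟩, ⟨⟨r, hr⟩, ⟨s, hs⟩⟩⟩ e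
    have e0 : (p + q * z) + (r * t + (s * z) * t) = 0 := e
    have e1 : r + s * z = 0 := by
      have := congrArg (· * w) e0
      simpa [add_mul, Rwt, Rwz, (hV p hp).2, (hV q hq).2, (hV r hr).2, (hV s hs).2] using this
    have e2 : s = 0 := by
      have := congrArg (· * u) e1
      simpa [add_mul, Ruz, (hV r hr).1, (hV s hs).1] using this
    have e3 : r = 0 := by simpa [e2] using e1
    have e4 : q = 0 := by
      have := congrArg (· * u) e0
      simpa [add_mul, e2, e3, Ruz, (hV p hp).1, (hV q hq).1] using this
    have e5 : p = 0 := by simpa [e2, e3, e4] using e0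
    subst e2 e3 e4 e5
    rfl
  have hle := LinearMap.finrank_le_finrank_of_injective hf
  rw [h.finrank_eq] at hle
  simp only [Module.finrank_prod] at hle
  omega

variable [SMulCommClass F O O]

/-- If `1, x, y` span a subalgebra, the structure constants are determined by two scalars. -/
theorem pair_closed (h : CayleyLaws F O) (h2 : (2 : F) ≠ 0) {x y : O}
    (hx : x ∈ imaginary F O) (hy : y ∈ imaginary F O) (hxy : LinearIndependent F ![x, y])
    (hc : y * x ∈ span F {(1 : O)} ⊔ span F {x, y}) :
    ∃ b d : F, y * x = -(b * d) • (1 : O) + b • x + d • y ∧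
      x * y = -(b * d) • (1 : O) - b • x - d • y ∧
      x * x = (d * d) • (1 : O) ∧ y * y = (b * b) • (1 : O) := by
  obtain ⟨a, b, d, e⟩ := mem_one_sup_span_pair.mp hc
  obtain ⟨p, hp⟩ := h.sq_imaginary x hx
  obtain ⟨q, hq⟩ := h.sq_imaginary y hy
  -- The involution reverses `yx` and negates `x` and `y`.
  have e' : x * y = a • (1 : O) - b • x - d • y := by
    have e1 := congrArg (involution F) e
    rw [AlgInvolution.conj_mul, mem_imaginary.mp hx, mem_imaginary.mp hy] at e1
    simp only [map_add, map_smul, mem_imaginary.mp hx, mem_imaginary.mp hy,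
      DicksonDouble.conj_one, neg_mul_neg] at e1
    rw [e1]
    module
  -- Coefficients in `(yx)x = y(xx)` give `a = -bd` and `x² = d²`; those in `y(yx) = (yy)x` give `y²
  -- = b²`.
  have r1 := h.right_alt x y
  have r2 := h.left_alt y x
  simp only [e, hp, hq, add_mul, mul_add, smul_mul_assoc, mul_smul_comm, one_mul, mul_one] at r1 r2
  obtain ⟨-, c2, c3⟩ := h.coeffs_eq_zero h2 hx hy hxy (a := b * p + d * a) (b := a + d * b)
    (d := d * d - p) (by linear_combination (norm := module) r1)
  obtain ⟨-, c5, -⟩ := h.coeffs_eq_zero h2 hx hy hxy (a := b * a + d * q) (b := b * b - q)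
    (d := a + b * d) (by linear_combination (norm := module) r2)
  have ha : a = -(b * d) := by linear_combination c2
  refine ⟨b, d, by rw [e, ha], by rw [e', ha], by rw [hp]; congr 1; linear_combination -c3,
    by rw [hq]; congr 1; linear_combination -c5⟩

theorem pair_closed_isotropic (h : CayleyLaws F O) (h2 : (2 : F) ≠ 0) {x y : O}
    (hx : x ∈ imaginary F O) (hy : y ∈ imaginary F O) (hxy : LinearIndependent F ![x, y])
    (hc : y * x ∈ span F {(1 : O)} ⊔ span F {x, y}) (hxx : x * x = 0) :
    ∃ b : F, y * x = b • x ∧ x * y = -b • x ∧ y * y = (b * b) • (1 : O) := by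
  obtain ⟨b, d, e1, e2, e3, e4⟩ := h.pair_closed h2 hx hy hxy hc
  rw [hxx] at e3
  have hd : d = 0 := mul_self_eq_zero.mp (h.smul_one_eq_zero e3.symm)
  subst hd
  exact ⟨b, by rw [e1]; module, by rw [e2]; module, e4⟩

/-- With the constants of `pair_closed`, `bx + dy` is null because the cross term `xy + yx = -2bd`
cancels the squares, and `y` multiplies it by `b`. If `b = 0`, then `y` is null and serves instead.
-/
theorem exists_isotropic_pair (h : CayleyLaws F O) (h2 : (2 : F) ≠ 0) {x y : O}
    (hx : x ∈ imaginary F O) (hy : y ∈ imaginary F O) (hxy : LinearIndependent F ![x, y])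
    (hc : y * x ∈ span F {(1 : O)} ⊔ span F {x, y}) :
    ∃ (u v : O) (c : F), LinearIndependent F ![u, v] ∧ span F {u, v} = span F {x, y} ∧
      u * u = 0 ∧ v * u = c • u := by
  obtain ⟨b, d, e1, e2, e3, e4⟩ := h.pair_closed h2 hx hy hxy hc
  by_cases hb : b = 0
  · subst hb
    refine ⟨y, x, -d, LinearIndependent.pair_symm_iff.mp hxy, by rw [Set.pair_comm], ?_, ?_⟩
    · rw [e4]; module
    · rw [e2]; module
  · refine ⟨b • x + d • y, y, b, ?_, ?_, ?_, ?_⟩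
    · rw [LinearIndependent.pair_iff] at hxy ⊢
      intro s t hst
      obtain ⟨h1, h3⟩ := hxy (s * b) (s * d + t) (by linear_combination (norm := module) hst)
      have hs : s = 0 := (mul_eq_zero.mp h1).resolve_right hb
      exact ⟨hs, by simpa [hs] using h3⟩
    · apply le_antisymm
      · rw [span_le]
        rintro _ (rfl | rfl)
        · exact mem_span_pair.mpr ⟨b, d, rfl⟩
        · exact subset_span (Set.mem_insert_of_mem _ rfl)
      · rw [span_le]
        rintro _ (rfl | rfl)
        · refine mem_span_pair.mpr ⟨b⁻¹, -(b⁻¹ * d), ?_⟩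
          rw [smul_add, smul_smul, inv_mul_cancel₀ hb]
          module
        · exact subset_span (Set.mem_insert_of_mem _ rfl)
    · simp only [mul_add, add_mul, smul_mul_assoc, mul_smul_comm, e1, e2, e3, e4]
      module
    · simp only [mul_add, mul_smul_comm, e1, e4]
      module

/-- The common left annihilator of `u` and `w` contains both, and a dual pair for the null plane
bounds its dimension by two. -/
theorem mem_span_of_mul_null_eq_zero (h : CayleyLaws F O) {u w p : O}
    (hu : u ∈ imaginary F O) (hw : w ∈ imaginary F O) (hli : LinearIndependent F ![u, w])
    (huu : u * u = 0) (hww : w * w = 0) (huw : u * w = 0) (hwu : w * u = 0)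
    (hpu : p * u = 0) (hpw : p * w = 0) : p ∈ span F {u, w} := by
  have := h.finite
  have hu0 : u ≠ 0 := hli.ne_zero 0
  obtain ⟨z, hz, huz⟩ := h.nondegenerate u hu hu0
  obtain ⟨k, hk⟩ := h.exists_polar hw hz
  have hv0 : w - k • u ≠ 0 := by
    intro h0
    have := (LinearIndependent.pair_iff.mp hli (-k) 1 (by rw [← h0]; module)).2
    exact _root_.one_ne_zero this
  -- Gram-Schmidt: `w - ku` is orthogonal to `z`, and later `t - lz` is orthogonal to `u`, so the
  -- two pairs are dual.
  obtain ⟨t, ht, hvt⟩ := h.nondegenerate (w - k • u) (sub_mem hw (smul_mem _ _ hu)) hv0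
  obtain ⟨l, hl⟩ := h.exists_polar hu ht
  have hvz : (w - k • u) * z + z * (w - k • u) = 0 := by
    simp only [sub_mul, mul_sub, smul_mul_assoc, mul_smul_comm]
    linear_combination (norm := module) hk - k • huz
  by_contra hp
  let V : Submodule F O := LinearMap.ker (LinearMap.mulRight F u) ⊓
    LinearMap.ker (LinearMap.mulRight F w)
  have hVle : Module.finrank F V ≤ 2 := by
    refine h.finrank_le_two_of_dual (u := u) (w := w - k • u) (z := z) (t := t - l • z)
      huz hvz ?_ ?_ V ?_
    · simp only [sub_mul, mul_sub, smul_mul_assoc, mul_smul_comm]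
      linear_combination (norm := module) hl - l • huz
    · rw [mul_sub (w - k • u) t, sub_mul t, mul_smul_comm, smul_mul_assoc]
      linear_combination (norm := module) hvt - l • hvz
    · intro q hq
      have h1 : q * u = 0 := hq.1
      have h3 : q * w = 0 := hq.2
      exact ⟨h1, by rw [mul_sub, mul_smul_comm, h1, h3, smul_zero, sub_zero]⟩
  have hle : span F {u, w} ≤ V := by
    rw [span_le]
    rintro _ (rfl | rfl)
    · exact ⟨huu, huw⟩
    · exact ⟨hwu, hww⟩
  have hlt : span F {u, w} < V := lt_of_le_of_ne hle (fun heq => hp (by rw [heq]; exact ⟨hpu, hpw⟩))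
  have := finrank_lt_finrank_of_lt hlt
  rw [hli.finrank_span_pair] at this
  omega

/-- Only `yx` needs testing: squares are scalars, and `xy` differs from `-yx` by a scalar. -/
theorem mul_mem_one_sup_of_pair (h : CayleyLaws F O) {x y : O} (hx : x ∈ imaginary F O)
    (hy : y ∈ imaginary F O) (hc : y * x ∈ span F {(1 : O)} ⊔ span F {x, y}) {a b : O}
    (ha : a ∈ span F {x, y}) (hb : b ∈ span F {x, y}) :
    a * b ∈ span F {(1 : O)} ⊔ span F {x, y} := by
  have hone : ∀ c : F, c • (1 : O) ∈ span F {(1 : O)} ⊔ span F {x, y} := fun c =>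
    mem_sup_left (smul_mem _ _ (mem_span_singleton_self _))
  refine mul_mem_span_of_forall_mem ?_ ha hb
  obtain ⟨p, hp⟩ := h.sq_imaginary x hx
  obtain ⟨q, hq⟩ := h.sq_imaginary y hy
  obtain ⟨s, hs⟩ := h.exists_polar hx hy
  rintro _ (rfl | rfl) _ (rfl | rfl)
  · rw [hp]; exact hone _
  · rw [eq_sub_of_add_eq hs]; exact sub_mem (hone _) hc
  · exact hc
  · rw [hq]; exact hone _

/-- A three-dimensional space of imaginary elements contains a plane that does not span a
subalgebra together with `1`. -/
theorem exists_pair_not_closed (h : CayleyLaws F O) (h2 : (2 : F) ≠ 0) {W : Submodule F O}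
    (hW : W ≤ imaginary F O) (hr : Module.finrank F W = 3) :
    ∃ x ∈ W, ∃ y ∈ W, LinearIndependent F ![x, y] ∧
      y * x ∉ span F {(1 : O)} ⊔ span F {x, y} := by
  have := h.finite
  by_contra! H
  have isotropic : ∀ x ∈ W, ∀ y ∈ W, LinearIndependent F ![x, y] →
      ∃ u ∈ span F {x, y}, u ≠ 0 ∧ u * u = 0 := by
    intro x hx y hy hxy
    obtain ⟨u, v, c, huv, hs, huu, -⟩ :=
      h.exists_isotropic_pair h2 (hW hx) (hW hy) hxy (H x hx y hy hxy)
    exact ⟨u, by rw [← hs]; exact subset_span (Set.mem_insert _ _), huv.ne_zero 0, huu⟩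
  have pair_le : ∀ x ∈ W, ∀ y ∈ W, span F {x, y} ≤ W := by
    intro x hx y hy
    rw [span_le]
    rintro _ (rfl | rfl)
    exacts [hx, hy]
  have outside : ∀ x y : O, ∃ z ∈ W, z ∉ span F {x, y} := fun x y =>
    exists_mem_notMem_of_finrank_lt (by have := finrank_span_pair_le (F := F) x y; omega)
  have outside_one : ∀ x : O, ∃ z ∈ W, z ∉ span F {x} := fun x => by
    simpa using outside x x
  obtain ⟨u, hu, hu0, huu⟩ : ∃ u ∈ W, u ≠ 0 ∧ u * u = 0 := by
    obtain ⟨x, hx, hx0⟩ := outside_one 0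
    obtain ⟨y, hy, hyx⟩ := outside_one x
    have hx0 : x ≠ 0 := fun h0 => hx0 (by rw [h0]; exact zero_mem _)
    obtain ⟨u, hu, h'⟩ := isotropic x hx y hy (.pair_of_notMem_span hx0 hyx)
    exact ⟨u, pair_le x hx y hy hu, h'⟩
  -- The plane of `y` and `z` misses `u`, so its null vector is independent of `u`.
  obtain ⟨w, hw, huw, hww⟩ : ∃ w ∈ W, LinearIndependent F ![u, w] ∧ w * w = 0 := by
    obtain ⟨y, hy, hyu⟩ := outside_one u
    obtain ⟨z, hz, hzu⟩ := outside u y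
    have hy0 : y ≠ 0 := fun h0 => hyu (by rw [h0]; exact zero_mem _)
    have hzy : z ∉ span F {y} := fun h' => hzu (span_mono (Set.subset_insert _ _) h')
    obtain ⟨w, hw, hw0, hww⟩ := isotropic y hy z hz (.pair_of_notMem_span hy0 hzy)
    refine ⟨w, pair_le y hy z hz hw, .pair_of_notMem_span hu0 ?_, hww⟩
    intro hwu
    obtain ⟨a, b, rfl⟩ := mem_span_pair.mp hw
    obtain ⟨c, hc⟩ := mem_span_singleton.mp hwu
    have hb : b = 0 := by
      by_contra hb
      refine hzu (mem_span_pair.mpr ⟨b⁻¹ * c, -(b⁻¹ * a), ?_⟩)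
      rw [mul_smul, hc, smul_add, smul_smul b⁻¹ b, inv_mul_cancel₀ hb]
      module
    subst hb
    have ha : a = 0 := by
      by_contra ha
      refine hyu (mem_span_singleton.mpr ⟨a⁻¹ * c, ?_⟩)
      rw [mul_smul, hc, smul_add, smul_smul a⁻¹ a, inv_mul_cancel₀ ha]
      module
    subst ha
    apply hw0
    module
  obtain ⟨v, hv, hvuw⟩ := outside u w
  have indep : ∀ s t : F, s • u + t • w ≠ 0 → LinearIndependent F ![s • u + t • w, v] := by
    intro s t h0
    refine .pair_of_notMem_span h0 fun hmem => hvuw ?_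
    exact (span_singleton_le_iff_mem _ _).mpr (mem_span_pair.mpr ⟨s, t, rfl⟩) hmem
  -- Since `w² = b²` and `w` is null, `b = 0`: the plane of `u` and `w` has zero multiplication.
  obtain ⟨b, hb1, hb2, hb3⟩ :=
    h.pair_closed_isotropic h2 (hW hu) (hW hw) huw (H u hu w hw huw) huu
  have hb : b = 0 := mul_self_eq_zero.mp (h.smul_one_eq_zero (by rw [← hb3, hww]))
  rw [hb, zero_smul] at hb1
  rw [hb, neg_zero, zero_smul] at hb2
  have act : ∀ s t : F, s • u + t • w ≠ 0 → ∃ c : F, v * (s • u + t • w) = c • (s • u + t • w) := by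
    intro s t h0
    have hm : s • u + t • w ∈ W := add_mem (smul_mem _ _ hu) (smul_mem _ _ hw)
    obtain ⟨c, hc, -⟩ := h.pair_closed_isotropic h2 (hW hm) (hW hv) (indep s t h0)
      (H _ hm v hv (indep s t h0)) (by
        simp only [mul_add, add_mul, smul_mul_assoc, mul_smul_comm, huu, hww, hb1, hb2]
        module)
    exact ⟨c, hc⟩
  have huw' := LinearIndependent.pair_iff.mp huw
  -- Testing the eigenvectors `u`, `w` and `u + w` forces a single eigenvalue, so `v - c₁` kills
  -- both `u` and `w`.
  obtain ⟨c₁, h₁⟩ := act 1 0 (fun h0 => _root_.one_ne_zero (huw' 1 0 h0).1)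
  obtain ⟨c₂, h₂⟩ := act 0 1 (fun h0 => _root_.one_ne_zero (huw' 0 1 h0).2)
  obtain ⟨c₃, h₃⟩ := act 1 1 (fun h0 => _root_.one_ne_zero (huw' 1 1 h0).1)
  simp only [one_smul, zero_smul, add_zero, zero_add, mul_add] at h₁ h₂ h₃
  rw [h₁, h₂] at h₃
  obtain ⟨d₁, d₂⟩ := huw' (c₁ - c₃) (c₂ - c₃) (by linear_combination (norm := module) h₃)
  have d₃ : c₂ = c₁ := by linear_combination d₂ - d₁
  have hmem : v - c₁ • (1 : O) ∈ span F {u, w} := by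
    refine h.mem_span_of_mul_null_eq_zero (hW hu) (hW hw) huw huu hww hb2 hb1 ?_ ?_
    · rw [sub_mul, h₁, smul_mul_assoc, one_mul, sub_self]
    · rw [sub_mul, h₂, d₃, smul_mul_assoc, one_mul, sub_self]
  have hc : c₁ = 0 := by
    apply h.eq_zero_of_smul_one_mem h2
    rw [← sub_sub_cancel v (c₁ • (1 : O))]
    exact sub_mem (hW hv) (hW (pair_le u hu w hw hmem))
  rw [hc, zero_smul, sub_zero] at hmem
  exact hvuw hmem

end CayleyLaws

/-! ### Generated subalgebras, nilpotent lines and the four types -/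

theorem subset_generatedSubalgebra {F O : Type*} [Field F] [NonAssocRing O] [Module F O]
    [IsScalarTower F O O] [SMulCommClass F O O] (s : Set O) :
    insert 1 s ⊆ (generatedSubalgebra F s : Set O) :=
  NonUnitalAlgebra.subset_adjoin F

theorem generatedSubalgebra_le {F O : Type*} [Field F] [NonAssocRing O] [Module F O]
    [IsScalarTower F O O] [SMulCommClass F O O] {s : Set O} {H : NonUnitalSubalgebra F O}
    (h1 : (1 : O) ∈ H) (hs : s ⊆ H) : generatedSubalgebra F s ≤ H :=
  NonUnitalAlgebra.adjoin_le (Set.insert_subset h1 hs)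

namespace CayleyLaws

section Nilpotent

variable {F O : Type*} [Field F] [NonAssocRing O] [Module F O] [AlgInvolution F O]
  [IsScalarTower F O O]

/-- If `x² = c` with `c ≠ 0`, left alternativity lets one cancel `x` on the left, so a vanishing
power would descend to `1 = 0`. -/
theorem isNilpotentElt_iff (h : CayleyLaws F O) {x : O} (hx : x ∈ imaginary F O) :
    IsNilpotentElt x ↔ x * x = 0 := by
  constructor
  · rintro ⟨n, hn⟩
    obtain ⟨c, hc⟩ := h.sq_imaginary x hx
    by_contra hxx
    have hc0 : c ≠ 0 := fun h0 => hxx (by rw [hc, h0, zero_smul])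
    induction n with
    | zero => exact h.one_ne_zero hn
    | succ n ih =>
      apply ih
      have h1 := h.left_alt x (nonAssocPow x n)
      rw [show x * nonAssocPow x n = 0 from hn, mul_zero, hc, smul_mul_assoc, one_mul] at h1
      exact (smul_eq_zero.mp h1.symm).resolve_left hc0
  · intro hxx
    exact ⟨2, by simp [nonAssocPow, hxx]⟩

variable [SMulCommClass F O O]

theorem mem_nilpotentLines_iff (h : CayleyLaws F O) {U : Submodule F O}
    (hU : U ≤ imaginary F O) {L : Submodule F O} :
    L ∈ nilpotentLines U ↔ ∃ x ∈ U, x ≠ 0 ∧ x * x = 0 ∧ L = span F {x} := by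
  constructor
  · rintro ⟨hLU, hL, hn⟩
    obtain ⟨⟨x, hx⟩, hx0, hspan⟩ := finrank_eq_one_iff'.mp hL
    refine ⟨x, hLU hx, fun h0 => hx0 (Subtype.ext h0),
      (h.isNilpotentElt_iff (hU (hLU hx))).mp (hn x hx), le_antisymm ?_ ?_⟩
    · intro y hy
      obtain ⟨c, hc⟩ := hspan ⟨y, hy⟩
      exact mem_span_singleton.mpr ⟨c, congrArg Subtype.val hc⟩
    · exact (span_singleton_le_iff_mem _ _).mpr hx
  · rintro ⟨x, hx, hx0, hxx, rfl⟩
    refine ⟨(span_singleton_le_iff_mem _ _).mpr hx, finrank_span_singleton hx0, ?_⟩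
    intro y hy
    obtain ⟨c, rfl⟩ := mem_span_singleton.mp hy
    rw [h.isNilpotentElt_iff (hU (smul_mem _ _ hx)), smul_mul_assoc, mul_smul_comm, hxx,
      smul_zero, smul_zero]

/-- A plane of imaginary elements that does not span a subalgebra together with `1` has one of the
four types. -/
theorem type_of_not_closed (h : CayleyLaws F O) {U : Submodule F O} (hU : U ≤ imaginary F O)
    (hr : Module.finrank F U = 2)
    (hnc : ∃ a ∈ U, ∃ b ∈ U, a * b ∉ span F {(1 : O)} ⊔ U) :
    IsTypeQ U ∨ IsTypeM U ∨ IsTypeD U ∨ IsTypeJ U := by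
  have := h.finite
  rcases (nilpotentLines U).eq_empty_or_nonempty with hQ | ⟨L, hL⟩
  · exact Or.inl hQ
  right
  obtain ⟨u, hu, hu0, huu, -⟩ := (h.mem_nilpotentLines_iff hU).mp hL
  obtain ⟨v, hv, hli, rfl⟩ := exists_pair_of_finrank_eq_two hr hu hu0
  have hvu : v * u ∉ span F {(1 : O)} ⊔ span F {u, v} := by
    intro hc
    obtain ⟨a, ha, b, hb, hab⟩ := hnc
    exact hab (h.mul_mem_one_sup_of_pair (hU hu) (hU hv) hc ha hb)
  obtain ⟨q, hq⟩ := h.sq_imaginary v (hU hv)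
  obtain ⟨s, hs⟩ := h.exists_polar (hU hu) (hU hv)
  -- The form factors as `b(as + bq)`. If `s ≠ 0`, its zeros are the lines of `u` and `qu - sv`
  -- (type M); if `s = 0 ≠ q`, only the line of `u` (type D); if both vanish, every element is
  -- nilpotent (type J).
  have hsq : ∀ a b : F, (a • u + b • v) * (a • u + b • v) = (b * (a * s + b * q)) • (1 : O) := by
    intro a b
    simp only [mul_add, add_mul, smul_mul_assoc, mul_smul_comm, huu, hq]
    linear_combination (norm := module) (a * b) • hs
  by_cases hs0 : s = 0
  · right
    by_cases hq0 : q = 0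
    · right
      refine ⟨fun x hx => ?_, fun H => hvu ?_⟩
      · obtain ⟨a, b, rfl⟩ := mem_span_pair.mp hx
        rw [h.isNilpotentElt_iff (hU hx), hsq, hs0, hq0]
        module
      · rw [H v hv u hu]
        exact zero_mem _
    · left
      refine ⟨span F {u}, ?_, fun H => hvu ?_⟩
      · ext L
        rw [h.mem_nilpotentLines_iff hU, Set.mem_singleton_iff]
        constructor
        · rintro ⟨x, hx, hx0, hxx, rfl⟩
          obtain ⟨a, b, rfl⟩ := mem_span_pair.mp hx
          rw [hsq, hs0] at hxx
          have hb : b = 0 := by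
            have hz := h.smul_one_eq_zero hxx
            simpa [hq0] using hz
          subst hb
          rw [zero_smul, add_zero] at hx0 ⊢
          exact span_singleton_smul_eq (IsUnit.mk0 a fun h0 => hx0 (by rw [h0, zero_smul])) u
        · rintro rfl
          exact ⟨u, hu, hu0, huu, rfl⟩
      -- Here `vu = -uv`, so `uv` in the line of `u` would make the plane closed.
      · rw [hs0, zero_smul] at hs
        rw [eq_neg_of_add_eq_zero_right hs]
        have huL := H u (mem_span_singleton_self u) v hv
        exact neg_mem (mem_sup_right ((span_singleton_le_iff_mem _ _).mpr hu huL))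
  · left
    have hw : q • u + (-s) • v ∈ span F {u, v} := mem_span_pair.mpr ⟨q, -s, rfl⟩
    have hw0 : q • u + (-s) • v ≠ 0 := fun h0 =>
      hs0 (neg_eq_zero.mp (LinearIndependent.pair_iff.mp hli _ _ h0).2)
    have hlines : nilpotentLines (span F {u, v}) = {span F {u}, span F {q • u + (-s) • v}} := by
      ext L
      rw [h.mem_nilpotentLines_iff hU, Set.mem_insert_iff, Set.mem_singleton_iff]
      constructor
      · rintro ⟨x, hx, hx0, hxx, rfl⟩
        obtain ⟨a, b, rfl⟩ := mem_span_pair.mp hx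
        rw [hsq] at hxx
        rcases mul_eq_zero.mp (h.smul_one_eq_zero hxx) with hb | hab
        · left
          subst hb
          rw [zero_smul, add_zero] at hx0 ⊢
          exact span_singleton_smul_eq (IsUnit.mk0 a fun h0 => hx0 (by rw [h0, zero_smul])) u
        · right
          have hx' : a • u + b • v = (-(s⁻¹ * b)) • (q • u + (-s) • v) := by
            have ha : a = -(s⁻¹ * b) * q := by
              field_simp
              linear_combination hab
            have hb : b = -(s⁻¹ * b) * -s := by field_simp
            rw [smul_add, smul_smul, smul_smul, ← ha, ← hb]
          rw [hx'] at hx0 ⊢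
          exact span_singleton_smul_eq (IsUnit.mk0 _ fun h0 => hx0 (by rw [h0, zero_smul])) _
      · rintro (rfl | rfl)
        · exact ⟨u, hu, hu0, huu, rfl⟩
        · refine ⟨_, hw, hw0, ?_, rfl⟩
          rw [hsq]
          module
    rw [IsTypeM, hlines]
    refine Set.encard_pair fun heq => ?_
    obtain ⟨c, hc⟩ := mem_span_singleton.mp (heq ▸ mem_span_singleton_self (q • u + (-s) • v))
    have := (LinearIndependent.pair_iff.mp hli (q - c) (-s)
      (by linear_combination (norm := module) -hc)).2
    exact hs0 (neg_eq_zero.mp this)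

end Nilpotent

/-! ### Four-dimensional subalgebras and their generating planes -/

variable {F O : Type*} [Field F] [NonAssocRing O] [Module F O] [AlgInvolution F O]

theorem finrank_imPart (h : CayleyLaws F O) (h2 : (2 : F) ≠ 0) {H : NonUnitalSubalgebra F O}
    (h1 : (1 : O) ∈ H) (hH : Module.finrank F H = 4) : Module.finrank F (imPart H) = 3 := by
  have hH' : Module.finrank F H.toSubmodule = 4 := hH
  have := h.finrank_inf_imaginary h2 (S := H.toSubmodule) h1
  rw [imPart]
  omega

theorem finrank_imaginary (h : CayleyLaws F O) (h2 : (2 : F) ≠ 0) :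
    Module.finrank F (imaginary F O) = 7 := by
  have := h.finrank_inf_imaginary h2 (S := ⊤) mem_top
  rw [finrank_top, h.finrank_eq, top_inf_eq] at this
  omega

variable [IsScalarTower F O O] [SMulCommClass F O O]

theorem generatedSubalgebra_eq (h : CayleyLaws F O) (h2 : (2 : F) ≠ 0) {U : Submodule F O}
    (hU : U ≤ imaginary F O) (hr : Module.finrank F U = 2)
    (hnc : ∃ a ∈ U, ∃ b ∈ U, a * b ∉ span F {(1 : O)} ⊔ U) {H : NonUnitalSubalgebra F O}
    (h1 : (1 : O) ∈ H) (hH : Module.finrank F H = 4) (hUH : U ≤ H.toSubmodule) :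
    generatedSubalgebra F (U : Set O) = H := by
  have := h.finite
  obtain ⟨a, ha, b, hb, hab⟩ := hnc
  set G := generatedSubalgebra F (U : Set O)
  have hsub := subset_generatedSubalgebra (F := F) (U : Set O)
  have hUG : ∀ x ∈ U, x ∈ G := fun x hx => hsub (Set.mem_insert_of_mem _ hx)
  have hle : span F {(1 : O)} ⊔ U ≤ G.toSubmodule := by
    rw [sup_le_iff, span_singleton_le_iff_mem]
    exact ⟨hsub (Set.mem_insert _ _), hUG⟩
  have hlt : span F {(1 : O)} ⊔ U < G.toSubmodule :=
    lt_of_le_of_ne hle fun heq => hab (by rw [heq]; exact G.mul_mem' (hUG a ha) (hUG b hb))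
  have hcard := finrank_lt_finrank_of_lt hlt
  rw [h.finrank_one_sup h2 hU, hr] at hcard
  have hGH : G.toSubmodule ≤ H.toSubmodule := generatedSubalgebra_le h1 hUH
  have hH' : Module.finrank F H.toSubmodule = 4 := hH
  exact NonUnitalSubalgebra.toSubmodule_injective (eq_of_le_of_finrank_le hGH (by omega))

theorem exists_generating_plane (h : CayleyLaws F O) (h2 : (2 : F) ≠ 0)
    {H : NonUnitalSubalgebra F O} (h1 : (1 : O) ∈ H) (hH : Module.finrank F H = 4) :
    ∃ U : Submodule F O, U ≤ imaginary F O ∧ Module.finrank F U = 2 ∧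
      (IsTypeQ U ∨ IsTypeM U ∨ IsTypeD U ∨ IsTypeJ U) ∧
      U ≤ H.toSubmodule ∧ generatedSubalgebra F (U : Set O) = H := by
  obtain ⟨x, hx, y, hy, hli, hnc⟩ :=
    h.exists_pair_not_closed h2 (W := imPart H) inf_le_right (h.finrank_imPart h2 h1 hH)
  have hle : span F {x, y} ≤ imPart H := by
    rw [span_le]
    rintro _ (rfl | rfl)
    exacts [hx, hy]
  have hU : span F {x, y} ≤ imaginary F O := hle.trans inf_le_right
  have hUH : span F {x, y} ≤ H.toSubmodule := hle.trans inf_le_left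
  have hnc' : ∃ a ∈ span F {x, y}, ∃ b ∈ span F {x, y},
      a * b ∉ span F {(1 : O)} ⊔ span F {x, y} :=
    ⟨y, subset_span (Set.mem_insert_of_mem _ rfl), x, subset_span (Set.mem_insert _ _), hnc⟩
  exact ⟨_, hU, hli.finrank_span_pair, h.type_of_not_closed hU hli.finrank_span_pair hnc', hUH,
    h.generatedSubalgebra_eq h2 hU hli.finrank_span_pair hnc' h1 hH hUH⟩

/-! ### Subalgebras through a given plane -/

/-- The span of `1, x, y, yx` is closed under multiplication. -/
theorem mul_mem_span_quadruple (h : CayleyLaws F O) {x y : O} (hx : x ∈ imaginary F O)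
    (hy : y ∈ imaginary F O) {a b : O} (ha : a ∈ span F {1, x, y, y * x})
    (hb : b ∈ span F {1, x, y, y * x}) : a * b ∈ span F {1, x, y, y * x} := by
  refine mul_mem_span_of_forall_mem ?_ ha hb
  obtain ⟨p, hp⟩ := h.sq_imaginary x hx
  obtain ⟨q, hq⟩ := h.sq_imaginary y hy
  obtain ⟨s, hs⟩ := h.exists_polar hx hy
  obtain ⟨c, hc⟩ := h.exists_sub_mem (y * x)
  obtain ⟨r, hr⟩ := h.sq_imaginary _ hc
  have m1 : (1 : O) ∈ span F {1, x, y, y * x} := subset_span (by simp)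
  have mx : x ∈ span F {1, x, y, y * x} := subset_span (by simp)
  have my : y ∈ span F {1, x, y, y * x} := subset_span (by simp)
  have mm : y * x ∈ span F {1, x, y, y * x} := subset_span (by simp)
  have exy : x * y = s • (1 : O) - y * x := eq_sub_of_add_eq hs
  rintro a (rfl | rfl | rfl | rfl) b (rfl | rfl | rfl | rfl)
  all_goals try simp only [one_mul, mul_one]
  all_goals try assumption
  · rw [hp]; exact smul_mem _ _ m1
  · rw [exy]; exact sub_mem (smul_mem _ _ m1) mm
  -- The product `x(yx)` comes from `x(xy) = x²y` on replacing `xy` by `s - yx`.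
  · have e := h.left_alt a y
    rw [exy, mul_sub, mul_smul_comm, mul_one, hp, smul_mul_assoc, one_mul] at e
    rw [← sub_sub_cancel (s • a) (a * (y * a)), e]
    exact sub_mem (smul_mem _ _ mx) (smul_mem _ _ my)
  · rw [hq]; exact smul_mem _ _ m1
  · rw [h.left_alt, hq, smul_mul_assoc, one_mul]; exact smul_mem _ _ mx
  · rw [h.right_alt, hp, mul_smul_comm, mul_one]; exact smul_mem _ _ my
  · have e := h.right_alt b x
    rw [exy, sub_mul, smul_mul_assoc, one_mul, hq, mul_smul_comm, mul_one] at e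
    rw [← sub_sub_cancel (s • b) ((b * x) * b), e]
    exact sub_mem (smul_mem _ _ my) (smul_mem _ _ mx)
  -- The imaginary part `yx - c` has scalar square, so `yx` satisfies a quadratic equation.
  · simp only [sub_mul, mul_sub, smul_mul_assoc, mul_smul_comm, one_mul, mul_one] at hr
    have e : (y * x) * (y * x) = (r - c * c) • (1 : O) + (2 * c) • (y * x) := by
      linear_combination (norm := module) hr
    rw [e]
    exact add_mem (smul_mem _ _ m1) (smul_mem _ _ mm)

/-- The subalgebra spanned by `1, x, y, yx` for imaginary `x, y`. -/
def pairSubalgebra (h : CayleyLaws F O) {x y : O} (hx : x ∈ imaginary F O)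
    (hy : y ∈ imaginary F O) : NonUnitalSubalgebra F O :=
  { span F {1, x, y, y * x} with
    mul_mem' := h.mul_mem_span_quadruple hx hy }

/-- Four spanning vectors bound the dimension above; `g` lying outside the three-dimensional `F1 ⊕
T` bounds it below. -/
theorem finrank_pairSubalgebra (h : CayleyLaws F O) (h2 : (2 : F) ≠ 0) {x y : O}
    (hx : x ∈ imaginary F O) (hy : y ∈ imaginary F O) {T : Submodule F O}
    (hT : T ≤ imaginary F O) (hr : Module.finrank F T = 2)
    (hTH : T ≤ (h.pairSubalgebra hx hy).toSubmodule) {g : O} (hg : g ∈ h.pairSubalgebra hx hy)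
    (hgT : g ∉ span F {(1 : O)} ⊔ T) : Module.finrank F (h.pairSubalgebra hx hy) = 4 := by
  have := h.finite
  have hle : span F {(1 : O)} ⊔ T ≤ (h.pairSubalgebra hx hy).toSubmodule := by
    rw [sup_le_iff, span_singleton_le_iff_mem]
    exact ⟨subset_span (by simp), hTH⟩
  have hlt := finrank_lt_finrank_of_lt
    (lt_of_le_of_ne hle fun heq => hgT (by rw [heq]; exact hg))
  rw [h.finrank_one_sup h2 hT, hr] at hlt
  have hub : Module.finrank F (span F {1, x, y, y * x}) ≤ 4 := by
    have hcard := finrank_range_le_card (R := F) ![1, x, y, y * x]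
    have hrange : Set.range ![1, x, y, y * x] = {1, x, y, y * x} := by
      simp only [Matrix.range_cons, Matrix.range_empty, Set.union_empty, Set.singleton_union]
    rwa [hrange, Set.finrank, Fintype.card_fin] at hcard
  exact le_antisymm hub hlt

/-- For a closed plane, with `u` null and `vu = cu`, the element `v` is recovered from a product:
`((v - c)z)u = v - c` when `uz + zu = 1`, because `(v - c)u = 0`. So `u` and the imaginary part `w`
of `(v - c)z` generate a subalgebra containing `v`. -/
theorem exists_subalgebra_of_plane (h : CayleyLaws F O) (h2 : (2 : F) ≠ 0) {T : Submodule F O}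
    (hT : T ≤ imaginary F O) (hr : Module.finrank F T = 2) :
    ∃ H : NonUnitalSubalgebra F O, (1 : O) ∈ H ∧ Module.finrank F H = 4 ∧ T ≤ imPart H := by
  have := h.finite
  have conclude : ∀ {x y g : O} (hx : x ∈ imaginary F O) (hy : y ∈ imaginary F O),
      T ≤ (h.pairSubalgebra hx hy).toSubmodule → g ∈ h.pairSubalgebra hx hy →
      g ∉ span F {(1 : O)} ⊔ T → ∃ H : NonUnitalSubalgebra F O,
        (1 : O) ∈ H ∧ Module.finrank F H = 4 ∧ T ≤ imPart H := fun hx hy hTH hg hgT =>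
    ⟨h.pairSubalgebra hx hy, subset_span (by simp),
      h.finrank_pairSubalgebra h2 hx hy hT hr hTH hg hgT, le_inf hTH hT⟩
  obtain ⟨x, y, hxy, rfl⟩ := exists_span_pair_of_finrank_eq_two hr
  have hx : x ∈ imaginary F O := hT (subset_span (by simp))
  have hy : y ∈ imaginary F O := hT (subset_span (by simp))
  by_cases hc : y * x ∈ span F {(1 : O)} ⊔ span F {x, y}
  · obtain ⟨u, v, c, huv, hs, huu, hvu⟩ := h.exists_isotropic_pair h2 hx hy hxy hc
    rw [← hs] at hT ⊢
    have hu : u ∈ imaginary F O := hT (subset_span (by simp))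
    have hv : v ∈ imaginary F O := hT (subset_span (by simp))
    obtain ⟨z, hz, huz⟩ := h.nondegenerate u hu (huv.ne_zero 0)
    obtain ⟨t, ht⟩ := h.exists_sub_mem ((v - c • (1 : O)) * z)
    set w := (v - c • (1 : O)) * z - t • (1 : O)
    have hwu : w * u = v - c • (1 : O) - t • u := by
      have e := h.mul_mul_add_mul_mul (v - c • (1 : O)) u z
      rw [huz, mul_one, sub_mul v _ u, hvu, smul_mul_assoc, one_mul, sub_self, zero_mul,
        zero_add] at e
      rw [sub_mul _ _ u, e, smul_mul_assoc, one_mul]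
    have m1 : (1 : O) ∈ span F {1, u, w, w * u} := subset_span (by simp)
    have mu : u ∈ span F {1, u, w, w * u} := subset_span (by simp)
    have mw : w * u ∈ span F {1, u, w, w * u} := subset_span (by simp)
    have mv : v ∈ span F {1, u, w, w * u} := by
      have e : v = w * u + c • (1 : O) + t • u := by rw [hwu]; module
      rw [e]
      exact add_mem (add_mem mw (smul_mem _ _ m1)) (smul_mem _ _ mu)
    rw [← hs] at conclude
    refine conclude hu ht (g := w) ?_ (subset_span (by simp)) ?_
    · rw [span_le]
      rintro _ (rfl | rfl)
      exacts [mu, mv]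
    -- If `w` lay in `F1 ⊕ T`, then `wu` would be a multiple of `u`, whereas its `v`-coefficient is
    -- `1`.
    · intro hw
      obtain ⟨a, b, d, e⟩ := mem_one_sup_span_pair.mp hw
      have e' := congrArg (· * u) e
      simp only [hwu, add_mul, smul_mul_assoc, one_mul, huu, hvu] at e'
      have := (h.coeffs_eq_zero h2 hu hv huv (a := -c) (b := -t - a - d * c) (d := 1)
        (by linear_combination (norm := module) e')).2.2
      exact _root_.one_ne_zero this
  · refine conclude hx hy ?_ (subset_span (by simp)) hc
    exact span_mono fun a ha => by rcases ha with rfl | rfl <;> simp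

end CayleyLaws

end

/-! ### The covering theorem -/

theorem mainTheorem8 {F : Type*} [Field F] (hF : ringChar F ≠ 2)
    {O : Type*} [NonAssocRing O] [Module F O] [IsScalarTower F O O] [SMulCommClass F O O]
    [AlgInvolution F O] (hO : IsCayleyAlgebra F O) :
    (∀ H : NonUnitalSubalgebra F O, (1 : O) ∈ H → Module.finrank F H = 4 →
      ∃ U : Submodule F O, U ≤ imaginary F O ∧ Module.finrank F U = 2 ∧
        (IsTypeQ U ∨ IsTypeM U ∨ IsTypeD U ∨ IsTypeJ U) ∧
        U ≤ H.toSubmodule ∧ generatedSubalgebra F (U : Set O) = H) ∧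
    Minimal (IsQCoveringDesign (imaginary F O) 7 3 2)
      {B : Submodule F O | ∃ H : NonUnitalSubalgebra F O,
        (1 : O) ∈ H ∧ Module.finrank F H = 4 ∧ B = imPart H} := by
  have h2 : (2 : F) ≠ 0 := Ring.two_ne_zero hF
  have h := hO.laws h2
  have := h.finite
  refine ⟨fun H h1 hH => h.exists_generating_plane h2 h1 hH, ?_, ?_⟩
  · refine ⟨inferInstance, h.finrank_imaginary h2, ?_, ?_, ?_⟩
    · rintro _ ⟨H, -, -, rfl⟩
      exact inf_le_right
    · rintro _ ⟨H, h1, hH, rfl⟩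
      exact h.finrank_imPart h2 h1 hH
    · intro T hT hr
      obtain ⟨H, h1, hH, hTH⟩ := h.exists_subalgebra_of_plane h2 hT hr
      exact ⟨_, ⟨H, h1, hH, rfl⟩, hTH⟩
  -- A covering subcollection has some `im(H')` containing a plane that generates `H`; then `H ≤
  -- H'`, and equal dimensions give `H = H'`.
  · rintro 𝓑 h𝓑 hsub _ ⟨H, h1, hH, rfl⟩
    obtain ⟨U, hU, hr, -, hUH, hgen⟩ := h.exists_generating_plane h2 h1 hH
    obtain ⟨B, hB, hUB⟩ := h𝓑.covers U hU hr
    obtain ⟨H', h1', hH', rfl⟩ := hsub hB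
    have hle : H ≤ H' := hgen ▸ generatedSubalgebra_le h1' (hUB.trans inf_le_left)
    have heq : H = H' := NonUnitalSubalgebra.toSubmodule_injective
      (Submodule.eq_of_le_of_finrank_eq hle (hH.trans hH'.symm))
    rwa [heq]
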